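/- For a finite-dimensional real Lie algebra $\mathfrak g$ let $(\Lambda\mathfrak g)^{\mathfrak g}$ and $(\Lambda\mathfrak g^*)^{\mathfrak g}$ denote the invariants in the exterior algebras of $\mathfrak g$ and of its dual, let $\Lambda^+$ denote the part of positive degree, and let $$P_{\mathfrak g^*}=\{\alpha\in(\Lambda^+\mathfrak g^*)^{\mathfrak g} : \alpha(x\wedge y)=0 \text{ for all } x,y\in(\Lambda^+\mathfrak g)^{\mathfrak g}\}$$ be the space of primitive elements. If $\theta$ is an involution of $\mathfrak g$, then $(P_{\mathfrak g^*})^{-\theta}$ denotes the $(-1)$-eigenspace of the map that $\theta$ induces on $P_{\mathfrak g^*}$. A reductive pair $(\mathfrak g,\mathfrak h)$ with Cartan involution $\theta$ consists of a (finite-dimensional, real) reductive Lie algebra $\mathfrak g$ with a Cartan involution $\theta$ and a subalgebra $\mathfrak h\subset\mathfrak g$ with $\theta(\mathfrak h)=\mathfrak h$. Restriction of forms then gives a well-defined linear map $\mathrm{rest}:(P_{\mathfrak g^*})^{-\theta}\to(P_{\mathfrak h^*})^{-\theta}$. Proposition. Let $(\mathfrak g_0,\mathfrak h_0)$ be a reductive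 pair with Cartan involution $\theta_0$. Let $\mathfrak g=\mathbb C\otimes\mathfrak g_0$ and $\mathfrak h=\mathbb C\otimes\mathfrak h_0$ be the complexifications, let $\mathfrak g_{\mathbb R},\mathfrak h_{\mathbb R}$ be $\mathfrak g,\mathfrak h$ regarded as real Lie algebras, and let $\theta$ be the Cartan involution of $\mathfrak g_{\mathbb R}$ that is the complex antilinear extension of $\theta_0$. Then restriction gives well-defined maps $$(P_{\mathfrak g_{\mathbb R}^*})^{-\theta}\to(P_{\mathfrak h_{\mathbb R}^*})^{-\theta}\quad\text{and}\quad (P_{\mathfrak g_0^*})^{-\theta_0}\to(P_{\mathfrak h_0^*})^{-\theta_0},$$ and if the first of these is surjective, then so is the second. -/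

import Mathlib

open scoped TensorProduct

namespace RedPair

/-! ### The derivation of the exterior algebra that extends a linear endomorphism -/

section Exterior

variable {V : Type*} [AddCommGroup V] [Module ℝ V]

/-- The linear map `v ↦ v + ε f(v)` from `V` to the dual numbers over `Λ V`. -/
noncomputable def derLin (f : V →ₗ[ℝ] V) :
    V →ₗ[ℝ] TrivSqZeroExt (ExteriorAlgebra ℝ V) (ExteriorAlgebra ℝ V) where
  toFun v := TrivSqZeroExt.inl (ExteriorAlgebra.ι ℝ v) +
    TrivSqZeroExt.inr (ExteriorAlgebra.ι ℝ (f v))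
  map_add' v w := by ext <;> simp
  map_smul' c v := by ext <;> simp

theorem derLin_sq (f : V →ₗ[ℝ] V) (v : V) : derLin f v * derLin f v = 0 := by
  ext
  · simp [derLin]
  · simp [derLin, ExteriorAlgebra.ι_add_mul_swap v (f v)]

/-- The algebra homomorphism `w ↦ w + ε D_f(w)` from `Λ V` to the dual numbers over `Λ V`. -/
noncomputable def derAlg (f : V →ₗ[ℝ] V) :
    ExteriorAlgebra ℝ V →ₐ[ℝ] TrivSqZeroExt (ExteriorAlgebra ℝ V) (ExteriorAlgebra ℝ V) :=
  ExteriorAlgebra.lift ℝ ⟨derLin f, derLin_sq f⟩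

/-- The derivation `D_f` of `Λ V` that extends `f : V → V`, that is,
`D_f (v₁ ∧ ⋯ ∧ vₖ) = ∑ᵢ v₁ ∧ ⋯ ∧ f(vᵢ) ∧ ⋯ ∧ vₖ`. The three lemmas below characterize it. -/
noncomputable def extDer (f : V →ₗ[ℝ] V) : ExteriorAlgebra ℝ V →ₗ[ℝ] ExteriorAlgebra ℝ V where
  toFun w := (derAlg f w).snd
  map_add' v w := by simp
  map_smul' c v := by simp

theorem extDer_one (f : V →ₗ[ℝ] V) : extDer f 1 = 0 := by
  simp [extDer]

theorem extDer_ι (f : V →ₗ[ℝ] V) (v : V) :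
    extDer f (ExteriorAlgebra.ι ℝ v) = ExteriorAlgebra.ι ℝ (f v) := by
  simp [extDer, derAlg, derLin]

theorem derAlg_fst (f : V →ₗ[ℝ] V) (w : ExteriorAlgebra ℝ V) : (derAlg f w).fst = w := by
  have h : (TrivSqZeroExt.fstHom ℝ (ExteriorAlgebra ℝ V) (ExteriorAlgebra ℝ V)).comp (derAlg f) =
      AlgHom.id ℝ (ExteriorAlgebra ℝ V) := by
    ext v
    simp [derAlg, derLin]
  exact DFunLike.congr_fun h w

theorem extDer_mul (f : V →ₗ[ℝ] V) (u w : ExteriorAlgebra ℝ V) :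
    extDer f (u * w) = extDer f u * w + u * extDer f w := by
  simp [extDer, derAlg_fst, add_comm]

end Exterior

/-! ### Invariants and primitive elements -/

section Primitive

variable (L : Type*) [LieRing L] [LieAlgebra ℝ L]

/-- `(Λ⁺ L)^L`: the elements of positive degree (zero component in `Λ⁰ L = ℝ`) of the exterior
algebra `Λ L` that are annihilated by `L`, which acts by the derivations extending `ad`. -/
noncomputable def posInvariants : Submodule ℝ (ExteriorAlgebra ℝ L) where
  carrier := {w | ExteriorAlgebra.algebraMapInv w = 0 ∧
    ∀ x : L, extDer (LieAlgebra.ad ℝ L x : L →ₗ[ℝ] L) w = 0}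
  add_mem' := by
    rintro a b ⟨ha, ha'⟩ ⟨hb, hb'⟩
    exact ⟨by simp [ha, hb], fun x => by simp [ha' x, hb' x]⟩
  zero_mem' := by simp
  smul_mem' := by
    rintro c a ⟨ha, ha'⟩
    exact ⟨by simp [ha], fun x => by simp [ha' x]⟩

/-- The space `P_{L^*}` of primitive elements in `(Λ L^*)^L`. For finite-dimensional `L`, elements
of `Λ L^*` are the same as linear forms on `Λ L`, and they are represented in this way. The
conditions say in turn: `α` has positive degree, `α` is `L`-invariant, and `α` vanishes on
products of two invariants of positive degree. -/
noncomputable def primitive : Submodule ℝ (Module.Dual ℝ (ExteriorAlgebra ℝ L)) where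
  carrier := {α | α 1 = 0 ∧
    (∀ (x : L) (w : ExteriorAlgebra ℝ L), α (extDer (LieAlgebra.ad ℝ L x : L →ₗ[ℝ] L) w) = 0) ∧
    ∀ u ∈ posInvariants L, ∀ w ∈ posInvariants L, α (u * w) = 0}
  add_mem' := by
    rintro a b ⟨ha, ha', ha''⟩ ⟨hb, hb', hb''⟩
    exact ⟨by simp [ha, hb], fun x w => by simp [ha' x w, hb' x w],
      fun u hu w hw => by simp [ha'' u hu w hw, hb'' u hu w hw]⟩
  zero_mem' := by simp
  smul_mem' := by
    rintro c a ⟨ha, ha', ha''⟩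
    exact ⟨by simp [ha], fun x w => by simp [ha' x w],
      fun u hu w hw => by simp [ha'' u hu w hw]⟩

variable {L}

/-- `(P_{L^*})^{-θ}`: the `(-1)`-eigenspace in `P_{L^*}` of the map induced by `θ : L → L`. -/
noncomputable def primitiveAnti (θ : L →ₗ[ℝ] L) :
    Submodule ℝ (Module.Dual ℝ (ExteriorAlgebra ℝ L)) where
  carrier := {α | α ∈ primitive L ∧
    ∀ w : ExteriorAlgebra ℝ L, α (ExteriorAlgebra.map θ w) = -α w}
  add_mem' := by
    rintro a b ⟨ha, ha'⟩ ⟨hb, hb'⟩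
    exact ⟨add_mem ha hb, fun w => by simp [ha' w, hb' w, add_comm]⟩
  zero_mem' := ⟨zero_mem _, by simp⟩
  smul_mem' := by
    rintro c a ⟨ha, ha'⟩
    exact ⟨Submodule.smul_mem _ _ ha, fun w => by simp [ha' w]⟩

/-- The restriction map `Λ L^* → Λ H^*` for a subalgebra `H` of `L`. -/
noncomputable def rest (H : LieSubalgebra ℝ L) :
    Module.Dual ℝ (ExteriorAlgebra ℝ L) →ₗ[ℝ] Module.Dual ℝ (ExteriorAlgebra ℝ H) :=
  Module.Dual.transpose (R := ℝ)
    (ExteriorAlgebra.map (H.incl : H →ₗ[ℝ] L)).toLinearMap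

end Primitive

/-! ### Reductive pairs -/

/-- `θ` is a Cartan involution of the real reductive Lie algebra `L`: an involutive automorphism
for which there is a `θ`-invariant and `ad`-invariant symmetric bilinear form `B` such that
`(x, y) ↦ -B(x, θ y)` is positive definite. The existence of such a `B` makes `L` reductive
(see `IsCartanInvolution.complementedLattice`); for semisimple `L` the Killing form will do, and for
reductive `L` the condition says that `-κ(x, θ x) > 0` for all `0 ≠ x ∈ [L, L]`, with `κ` the Killing
form, while `θ` may be any involution on the centre. -/
structure IsCartanInvolution {L : Type*} [LieRing L] [LieAlgebra ℝ L] (θ : L →ₗ⁅ℝ⁆ L) : Prop where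
  involutive : ∀ x, θ (θ x) = x
  exists_form : ∃ B : LinearMap.BilinForm ℝ L,
    (∀ x y, B x y = B y x) ∧
    (∀ x y z, B ⁅x, y⁆ z = B x ⁅y, z⁆) ∧
    (∀ x y, B (θ x) (θ y) = B x y) ∧
    ∀ x, x ≠ 0 → B x (θ x) < 0

/-- A Lie algebra with a Cartan involution is reductive: each ideal has a complementary ideal. -/
theorem IsCartanInvolution.complementedLattice {L : Type*} [LieRing L] [LieAlgebra ℝ L]
    [FiniteDimensional ℝ L] {θ : L →ₗ⁅ℝ⁆ L} (hθ : IsCartanInvolution θ) :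
    ComplementedLattice (LieIdeal ℝ L) := by
  obtain ⟨B, hsymm, hinv, hB, hpos⟩ := hθ.exists_form
  refine ⟨fun I => ?_⟩
  let J : LieIdeal ℝ L :=
    { carrier := {y | ∀ x ∈ I, B x (θ y) = 0}
      add_mem' := fun ha hb x hx => by simp [ha x hx, hb x hx]
      zero_mem' := fun x _ => by simp
      smul_mem' := fun c a ha x hx => by simp [ha x hx]
      lie_mem := fun {z a} ha x hx => by
        rw [LieHom.map_lie, ← hinv]
        exact ha _ (lie_mem_left ℝ L I _ _ hx) }
  have hinf : I ⊓ J = ⊥ := by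
    rw [eq_bot_iff]
    rintro x ⟨hxI, hxJ⟩
    by_contra hx
    exact (hpos x (by simpa using hx)).ne (hxJ x hxI)
  refine ⟨J, disjoint_iff.mpr hinf, codisjoint_iff.mpr ?_⟩
  let C : LinearMap.BilinForm ℝ L := B.compl₂ (θ : L →ₗ[ℝ] L)
  have hC : ∀ x y, C x y = B x (θ y) := fun x y => rfl
  have hCrefl : C.IsRefl := by
    intro x y h
    rw [hC] at h ⊢
    rw [← hB, hθ.involutive, hsymm, h]
  have hdisj : Disjoint I.toSubmodule (C.orthogonal I.toSubmodule) := by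
    rw [Submodule.disjoint_def]
    intro x hx hx'
    by_contra h
    exact (hpos x h).ne (hx' x hx)
  have hsup := ((LinearMap.BilinForm.isCompl_orthogonal_iff_disjoint hCrefl).mpr hdisj).sup_eq_top
  rw [← LieSubmodule.toSubmodule_inj, LieSubmodule.sup_toSubmodule]
  exact hsup

/-- A reductive pair `(L, H)`: a real reductive Lie algebra `L` with a Cartan involution `θ` and a
subalgebra `H` of `L` with `θ(H) = H`. -/
structure ReductivePair (L : Type*) [LieRing L] [LieAlgebra ℝ L] where
  θ : L →ₗ⁅ℝ⁆ L
  cartan : IsCartanInvolution θ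
  H : LieSubalgebra ℝ L
  map_H : H.map θ = H

namespace ReductivePair

variable {L : Type*} [LieRing L] [LieAlgebra ℝ L] (P : ReductivePair L)

theorem θ_mem {x : L} (hx : x ∈ P.H) : P.θ x ∈ P.H := by
  rw [← P.map_H]
  exact ⟨x, hx, rfl⟩

/-- The restriction of `θ` to `H`. -/
noncomputable def θH : P.H →ₗ[ℝ] P.H :=
  (P.θ : L →ₗ[ℝ] L).restrict (p := P.H.toSubmodule) (q := P.H.toSubmodule) fun _ hx => P.θ_mem hx

/-- Restriction carries `(P_{L^*})^{-θ}` into `(P_{H^*})^{-θ}`. -/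
def RestWellDefined : Prop :=
  ∀ α ∈ primitiveAnti (P.θ : L →ₗ[ℝ] L), rest P.H α ∈ primitiveAnti P.θH

/-- The restriction map `(P_{L^*})^{-θ} → (P_{H^*})^{-θ}`. -/
noncomputable def restAnti (h : P.RestWellDefined) :
    primitiveAnti (P.θ : L →ₗ[ℝ] L) →ₗ[ℝ] primitiveAnti P.θH :=
  (rest P.H).restrict h

/-- The antilinear extension `z ⊗ x ↦ conj z ⊗ θ x` of `θ` to `ℂ ⊗ L`, seen as a homomorphism of
real Lie algebras. -/
noncomputable def θConj : ℂ ⊗[ℝ] L →ₗ⁅ℝ⁆ ℂ ⊗[ℝ] L :=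
  LieAlgebra.ExtendScalars.map Complex.conjAe.toAlgHom P.θ

theorem θConj_isCartanInvolution : IsCartanInvolution P.θConj := by
  obtain ⟨B, hsymm, hinv, hθ, hpos⟩ := P.cartan.exists_form
  let R : LinearMap.BilinForm ℝ ℂ := (LinearMap.mul ℝ ℂ).compr₂ Complex.reLm
  let T : LinearMap.BilinForm ℝ (ℂ ⊗[ℝ] L) := LinearMap.BilinForm.tmul R B
  have hT : ∀ (a b : ℂ) (x y : L), T (a ⊗ₜ x) (b ⊗ₜ y) = (a * b).re * B x y := fun a b x y => by
    simp [T, R, mul_comm]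
  have hc : ∀ (a : ℂ) (x : L), P.θConj (a ⊗ₜ x) = (starRingEnd ℂ a) ⊗ₜ P.θ x := fun a x => rfl
  refine ⟨fun z => ?_, T, fun z w => ?_, fun z w v => ?_, fun z w => ?_, fun z hz => ?_⟩
  · induction z with
    | zero => simp
    | tmul a x => simp [hc, P.cartan.involutive x]
    | add a b ha hb => simp [ha, hb]
  · induction z with
    | zero => simp
    | add a b ha hb => simp [ha, hb]
    | tmul a x =>
      induction w with
      | zero => simp
      | add a b ha hb => simp [ha, hb]
      | tmul b y => rw [hT, hT, mul_comm a b, hsymm x y]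
  · induction z with
    | zero => simp
    | add a b ha hb => simp [ha, hb]
    | tmul a x =>
      induction w with
      | zero => simp
      | add a b ha hb => simp [ha, hb]
      | tmul b y =>
        induction v with
        | zero => simp
        | add a b ha hb => simp only [map_add, lie_add, ha, hb]
        | tmul c t =>
          simp only [LieAlgebra.ExtendScalars.bracket_tmul, hT, hinv, mul_assoc]
  · induction z with
    | zero => simp
    | add a b ha hb => simp [ha, hb]
    | tmul a x =>
      induction w with
      | zero => simp
      | add a b ha hb => simp [ha, hb]
      | tmul b y => rw [hc, hc, hT, hT, hθ, ← map_mul, Complex.conj_re]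
  · obtain ⟨x, y, rfl⟩ : ∃ x y : L, z = (1 : ℂ) ⊗ₜ[ℝ] x + Complex.I ⊗ₜ[ℝ] y := by
      clear hz
      induction z with
      | zero => exact ⟨0, 0, by simp⟩
      | add a b ha hb =>
        obtain ⟨x, y, rfl⟩ := ha
        obtain ⟨x', y', rfl⟩ := hb
        exact ⟨x + x', y + y', by simp only [TensorProduct.tmul_add]; abel⟩
      | tmul a x =>
        refine ⟨a.re • x, a.im • x, ?_⟩
        rw [← TensorProduct.smul_tmul, ← TensorProduct.smul_tmul, ← TensorProduct.add_tmul]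
        congr 1
        apply Complex.ext <;> simp
    have hle : ∀ x, B x (P.θ x) ≤ 0 := fun x => by
      rcases eq_or_ne x 0 with rfl | h
      · simp
      · exact (hpos x h).le
    have key : T ((1 : ℂ) ⊗ₜ[ℝ] x + Complex.I ⊗ₜ[ℝ] y)
        (P.θConj ((1 : ℂ) ⊗ₜ[ℝ] x + Complex.I ⊗ₜ[ℝ] y)) = B x (P.θ x) + B y (P.θ y) := by
      simp [hc, hT]
    rw [key]
    rcases eq_or_ne x 0 with rfl | hx
    · have hy : y ≠ 0 := by
        rintro rfl
        simp at hz
      simpa using hpos y hy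
    · linarith [hpos x hx, hle y]

/-- The complexification `ℂ ⊗ H`, as a subspace of `ℂ ⊗ L`, seen as a real Lie subalgebra. -/
noncomputable def HC : LieSubalgebra ℝ (ℂ ⊗[ℝ] L) :=
  (LieAlgebra.ExtendScalars.map (AlgHom.id ℝ ℂ) P.H.incl).range

/-- The complexification of a reductive pair, with `ℂ ⊗ L` and `ℂ ⊗ H` regarded as real Lie
algebras and with the Cartan involution that is the antilinear extension of `θ`. -/
noncomputable def complexify : ReductivePair (ℂ ⊗[ℝ] L) where
  θ := P.θConj
  cartan := P.θConj_isCartanInvolution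
  H := P.HC
  map_H := by
    have hsub : ∀ z ∈ P.HC, P.θConj z ∈ P.HC := by
      rintro _ ⟨w, rfl⟩
      refine ⟨TensorProduct.map Complex.conjAe.toAlgHom.toLinearMap P.θH w, ?_⟩
      induction w with
      | zero => simp
      | tmul a x => rfl
      | add a b ha hb => simp only [map_add, ha, hb]
    apply le_antisymm
    · rintro _ ⟨z, hz, rfl⟩
      exact hsub z hz
    · intro z hz
      exact ⟨P.θConj z, hsub z hz, P.θConj_isCartanInvolution.involutive z⟩

end ReductivePair

end RedPair

/-! Surjectivity passes through the complexification. Given `β` on `𝔥₀`, the real part of its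
complex multilinear extension is a primitive form on `𝔥_ℝ` (`reExtension_mem_primitiveAnti`). If `α`
on `𝔤_ℝ` restricts to that extension, then `α` restricted to `𝔤₀` is a preimage of `β`, since the
extension agrees with `β` on `Λ𝔥₀`. This uses that restriction preserves primitivity not only for `𝔥
⊂ 𝔤` but also for the real form `𝔤₀ ⊂ 𝔤_ℝ`, which is `θ`-stable too.

Hence the core is `IsCartanInvolution.comp_map_mem_primitive`. The difficulty is that invariants `u,
w` of `Λ𝔥` need not be `𝔤`-invariant in `Λ𝔤`. Lie algebra homology repairs this. Let `∂` be the
boundary operator on `Λ𝔤`. As `𝔥` is `θ`-stable, `u` and `w` are cycles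
(`IsBoundary.eq_zero_of_invariant`). The form `-B(x, θ y)` extends to an inner product on `Λ𝔤` for
which the adjoint of the action of `x` is minus the action of `θ x`, and orthogonal complements then
give complete reducibility. So `u = u' + ∂a` and `w = w' + ∂b` with `u', w'` invariant under `𝔤`,
and `b` may be chosen invariant under `𝔥`. By the product rule `IsBoundary.map_mul_of_invariant`,
`∂a ∧ w'` and `u ∧ ∂b` are boundaries. An invariant form kills boundaries, so `α(u ∧ w) = α(u' ∧ w')
= 0`. -/

namespace RedPair

/-! ### Contractions and derivations of the exterior algebra -/

section ExteriorCalculus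

open ExteriorAlgebra

variable {V W : Type*} [AddCommGroup V] [Module ℝ V] [AddCommGroup W] [Module ℝ W]

theorem exteriorAlgebra_left_induction {P : ExteriorAlgebra ℝ V → Prop}
    (algebraMap : ∀ r : ℝ, P (algebraMap ℝ _ r)) (add : ∀ x y, P x → P y → P (x + y))
    (ι_mul : ∀ x v, P x → P (ι ℝ v * x)) (w : ExteriorAlgebra ℝ V) : P w :=
  CliffordAlgebra.left_induction (Q := (0 : QuadraticForm ℝ V)) algebraMap add ι_mul w

/-- Contraction of an element of the exterior algebra with a linear form. -/
noncomputable def contract : Module.Dual ℝ V →ₗ[ℝ] Module.End ℝ (ExteriorAlgebra ℝ V) :=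
  CliffordAlgebra.contractLeft (Q := (0 : QuadraticForm ℝ V))

theorem contract_ι_mul (d : Module.Dual ℝ V) (v : V) (w : ExteriorAlgebra ℝ V) :
    contract d (ι ℝ v * w) = d v • w - ι ℝ v * contract d w :=
  CliffordAlgebra.contractLeft_ι_mul _ _ _

theorem contract_algebraMap (d : Module.Dual ℝ V) (r : ℝ) :
    contract d (algebraMap ℝ _ r) = 0 :=
  CliffordAlgebra.contractLeft_algebraMap _ _ _

theorem contract_contract (d : Module.Dual ℝ V) (w : ExteriorAlgebra ℝ V) :
    contract d (contract d w) = 0 :=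
  CliffordAlgebra.contractLeft_contractLeft _ _

theorem extDer_algebraMap (f : V →ₗ[ℝ] V) (r : ℝ) : extDer f (algebraMap ℝ _ r) = 0 := by
  rw [Algebra.algebraMap_eq_smul_one, map_smul, extDer_one, smul_zero]

theorem extDer_ι_mul (f : V →ₗ[ℝ] V) (v : V) (w : ExteriorAlgebra ℝ V) :
    extDer f (ι ℝ v * w) = ι ℝ (f v) * w + ι ℝ v * extDer f w := by
  rw [extDer_mul, extDer_ι]

theorem algebraMapInv_extDer (f : V →ₗ[ℝ] V) (w : ExteriorAlgebra ℝ V) :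
    algebraMapInv (extDer f w) = 0 := by
  induction w using exteriorAlgebra_left_induction with
  | algebraMap r => simp [extDer_algebraMap]
  | add x y hx hy => simp [hx, hy]
  | ι_mul x v hx => simp [extDer_ι_mul, algebraMapInv]

theorem map_extDer (φ : V →ₗ[ℝ] W) (f : V →ₗ[ℝ] V) (g : W →ₗ[ℝ] W)
    (h : ∀ v, φ (f v) = g (φ v)) (w : ExteriorAlgebra ℝ V) :
    ExteriorAlgebra.map φ (extDer f w) = extDer g (ExteriorAlgebra.map φ w) := by
  induction w using exteriorAlgebra_left_induction with
  | algebraMap r => simp [extDer_algebraMap]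
  | add x y hx hy => simp [hx, hy]
  | ι_mul x v hx => simp [extDer_ι_mul, hx, h]

theorem algebraMapInv_map (φ : V →ₗ[ℝ] W) (w : ExteriorAlgebra ℝ V) :
    algebraMapInv (ExteriorAlgebra.map φ w) = algebraMapInv w := by
  induction w using exteriorAlgebra_left_induction with
  | algebraMap r => simp
  | add x y hx hy => simp [hx, hy]
  | ι_mul x v hx => simp [algebraMapInv]

/-- The commutator of a contraction and a derivation is a contraction. -/
theorem contract_extDer (d : Module.Dual ℝ V) (f : V →ₗ[ℝ] V) (w : ExteriorAlgebra ℝ V) :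
    contract d (extDer f w) = extDer f (contract d w) + contract (d ∘ₗ f) w := by
  induction w using exteriorAlgebra_left_induction with
  | algebraMap r => simp [extDer_algebraMap, contract_algebraMap]
  | add x y hx hy => simp only [map_add, hx, hy]; abel
  | ι_mul x v hx =>
    simp only [extDer_ι_mul, contract_ι_mul, map_add, map_sub, map_smul, hx, mul_add,
      LinearMap.comp_apply]
    abel

theorem extDer_lie (f g : V →ₗ[ℝ] V) (w : ExteriorAlgebra ℝ V) :
    extDer (f ∘ₗ g - g ∘ₗ f) w = extDer f (extDer g w) - extDer g (extDer f w) := by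
  induction w using exteriorAlgebra_left_induction with
  | algebraMap r => simp [extDer_algebraMap]
  | add x y hx hy => simp only [map_add, hx, hy]; abel
  | ι_mul x v hx =>
    simp only [extDer_ι_mul, map_add, hx, LinearMap.sub_apply, LinearMap.comp_apply, map_sub,
      sub_mul, mul_sub]
    abel

theorem contract_mem_exteriorPower (d : Module.Dual ℝ V) (k : ℕ) {w : ExteriorAlgebra ℝ V}
    (hw : w ∈ ⋀[ℝ]^(k + 1) V) : contract d w ∈ ⋀[ℝ]^k V := by
  -- Degree 0 is carried along because the term `v ∧ contract d x` with `x` a scalar has no lower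
  -- degree to lie in; it has to vanish.
  have key : ∀ (n : ℕ) (x : ExteriorAlgebra ℝ V), x ∈ ⋀[ℝ]^n V →
      (n = 0 → contract d x = 0) ∧ ∀ m, n = m + 1 → contract d x ∈ ⋀[ℝ]^m V := by
    intro n x hx
    induction hx using Submodule.pow_induction_on_left' with
    | algebraMap r => exact ⟨fun _ => contract_algebraMap d r, fun m hm => by simp at hm⟩
    | add x y i hx hy hx' hy' =>
      refine ⟨fun h => by rw [map_add, hx'.1 h, hy'.1 h, add_zero], fun m hm => ?_⟩
      rw [map_add]
      exact add_mem (hx'.2 m hm) (hy'.2 m hm)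
    | mem_mul v hv i x hx hx' =>
      refine ⟨fun h => by simp at h, fun m hm => ?_⟩
      obtain rfl : i = m := by simpa using hm
      obtain ⟨v, rfl⟩ := hv
      rw [contract_ι_mul]
      refine sub_mem (Submodule.smul_mem _ _ hx) ?_
      cases i with
      | zero => simp [hx'.1 rfl]
      | succ i =>
        rw [exteriorPower, pow_succ']
        exact Submodule.mul_mem_mul (LinearMap.mem_range_self _ _) (hx'.2 i rfl)
  exact (key _ w hw).2 k rfl

/-- The derivation extending the identity is the degree operator. It yields both the orthogonality
of distinct degrees and, by Euler's formula, positivity of the pairing. -/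
theorem extDer_id_of_mem_exteriorPower (k : ℕ) {w : ExteriorAlgebra ℝ V}
    (hw : w ∈ ⋀[ℝ]^k V) : extDer LinearMap.id w = (k : ℝ) • w := by
  induction hw using Submodule.pow_induction_on_left' with
  | algebraMap r => simp [extDer_algebraMap]
  | add x y i hx hy hx' hy' => rw [map_add, hx', hy', smul_add]
  | mem_mul v hv i x hx hx' =>
    obtain ⟨v, rfl⟩ := hv
    rw [extDer_ι_mul, hx', LinearMap.id_apply, Nat.cast_succ, add_smul, one_smul, add_comm,
      mul_smul_comm]

instance finiteDimensional_exteriorAlgebra [FiniteDimensional ℝ V] :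
    FiniteDimensional ℝ (ExteriorAlgebra ℝ V) :=
  Module.Finite.of_basis (Module.finBasis ℝ V).ExteriorAlgebra

end ExteriorCalculus

/-! ### The inner product on the exterior algebra -/

section Pairing

open ExteriorAlgebra

variable {V : Type*} [AddCommGroup V] [Module ℝ V] (g : LinearMap.BilinForm ℝ V)

/-- The action of `Λ V` on itself by contractions that is determined by a bilinear form. -/
noncomputable def contractAlg : ExteriorAlgebra ℝ V →ₐ[ℝ] Module.End ℝ (ExteriorAlgebra ℝ V) :=
  ExteriorAlgebra.lift ℝ ⟨contract ∘ₗ g, fun v => by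
    exact LinearMap.ext fun w => contract_contract (g v) w⟩

/-- The extension of a bilinear form on `V` to the exterior algebra `Λ V`. -/
noncomputable def pairing : LinearMap.BilinForm ℝ (ExteriorAlgebra ℝ V) :=
  ((contractAlg g).toLinearMap ∘ₗ CliffordAlgebra.reverse).compr₂ algebraMapInv.toLinearMap

theorem pairing_algebraMap (r : ℝ) (w : ExteriorAlgebra ℝ V) :
    pairing g (algebraMap ℝ _ r) w = r * algebraMapInv w := by
  have h : CliffordAlgebra.reverse (Q := (0 : QuadraticForm ℝ V))
      (algebraMap ℝ (ExteriorAlgebra ℝ V) r) = algebraMap ℝ (ExteriorAlgebra ℝ V) r :=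
    CliffordAlgebra.reverse.commutes r
  simp [pairing, h]

/-- The reversal in `pairing` makes the leftmost factor contract first. This recursion drives every
later induction on the pairing. -/
theorem pairing_ι_mul (v : V) (w w' : ExteriorAlgebra ℝ V) :
    pairing g (ι ℝ v * w) w' = pairing g w (contract (g v) w') := by
  have h : CliffordAlgebra.reverse (Q := (0 : QuadraticForm ℝ V)) (ι ℝ v * w) =
      CliffordAlgebra.reverse (Q := (0 : QuadraticForm ℝ V)) w * ι ℝ v := by
    have := CliffordAlgebra.reverse.map_mul (Q := (0 : QuadraticForm ℝ V)) (ι ℝ v) w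
    rw [this]
    congr 1
    exact CliffordAlgebra.reverse_ι v
  simp only [pairing, LinearMap.compr₂_apply, LinearMap.comp_apply, AlgHom.toLinearMap_apply]
  rw [h, map_mul]
  simp [contractAlg]

variable {g}

theorem pairing_ι_mul_right (hg : ∀ x y, g x y = g y x) (v : V) (w w' : ExteriorAlgebra ℝ V) :
    pairing g w (ι ℝ v * w') = pairing g (contract (g v) w) w' := by
  induction w using exteriorAlgebra_left_induction generalizing w' with
  | algebraMap r => simp [pairing_algebraMap, contract_algebraMap, algebraMapInv]
  | add x y hx hy => simp only [map_add, LinearMap.add_apply, hx, hy]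
  | ι_mul x u hx =>
    simp only [pairing_ι_mul, contract_ι_mul, map_sub, map_smul, hx, LinearMap.sub_apply,
      LinearMap.smul_apply, hg u v]

theorem pairing_comm (hg : ∀ x y, g x y = g y x) (w w' : ExteriorAlgebra ℝ V) :
    pairing g w w' = pairing g w' w := by
  induction w using exteriorAlgebra_left_induction generalizing w' with
  | algebraMap r =>
    rw [pairing_algebraMap]
    induction w' using exteriorAlgebra_left_induction with
    | algebraMap s => simp [pairing_algebraMap, mul_comm]
    | add x y hx hy => simp only [map_add, LinearMap.add_apply, mul_add, hx, hy]
    | ι_mul x u hx => simp [pairing_ι_mul, contract_algebraMap, algebraMapInv]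
  | add x y hx hy => simp only [map_add, LinearMap.add_apply, hx, hy]
  | ι_mul x u hx => rw [pairing_ι_mul, pairing_ι_mul_right hg, hx]

/-- Contraction with `g u` and the derivation of `f'` commute up to contraction with `g u ∘ f' = g
(f u)`, which is the term that `f u ∧ x` contributes on the left. -/
theorem pairing_extDer (f f' : V →ₗ[ℝ] V) (hf : ∀ x y, g (f x) y = g x (f' y))
    (w w' : ExteriorAlgebra ℝ V) :
    pairing g (extDer f w) w' = pairing g w (extDer f' w') := by
  induction w using exteriorAlgebra_left_induction generalizing w' with
  | algebraMap r => simp [pairing_algebraMap, extDer_algebraMap, algebraMapInv_extDer]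
  | add x y hx hy => simp only [map_add, LinearMap.add_apply, hx, hy]
  | ι_mul x u hx =>
    have h : g u ∘ₗ f' = g (f u) := by
      ext y
      exact (hf u y).symm
    rw [extDer_ι_mul, map_add, LinearMap.add_apply, pairing_ι_mul, pairing_ι_mul, pairing_ι_mul,
      hx, contract_extDer, map_add, h, add_comm]

/-- A symmetric positive definite form has an orthonormal basis on each subspace of finite
dimension. -/
theorem exists_orthonormal_expansion (hg : ∀ x y, g x y = g y x) (hpos : ∀ x, x ≠ 0 → 0 < g x x)
    (K : Submodule ℝ V) [FiniteDimensional ℝ K] :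
    ∃ (n : ℕ) (e : Fin n → V), (∀ i, e i ∈ K) ∧ ∀ x ∈ K, x = ∑ i, g (e i) x • e i := by
  let core : InnerProductSpace.Core ℝ K :=
    { inner := fun x y => g x y
      conj_inner_symm := fun x y => hg _ _
      re_inner_nonneg := fun x => by
        rcases eq_or_ne (x : V) 0 with h | h
        · simp [h]
        · exact (hpos _ h).le
      add_left := fun x y z => by simp
      smul_left := fun x y r => by simp
      definite := fun x hx => by
        by_contra h
        exact (hpos x (by simpa using h)).ne' hx }
  let _ : NormedAddCommGroup K := core.toNormedAddCommGroup
  let _ : InnerProductSpace ℝ K := InnerProductSpace.ofCore core.toCore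
  let b := stdOrthonormalBasis ℝ K
  refine ⟨_, fun i => (b i : V), fun i => (b i).2, fun x hx => ?_⟩
  have h := congrArg K.subtype (b.sum_repr' ⟨x, hx⟩)
  rw [map_sum] at h
  exact h.symm

variable {ι' : Type*} [Fintype ι']

/-- The expansion of the derivation `D_f` in terms of contractions. -/
theorem sum_ι_mul_contract (f : V →ₗ[ℝ] V) {K : Submodule ℝ V} (e : ι' → V)
    (he : ∀ x ∈ K, x = ∑ i, g (e i) x • e i) {w : ExteriorAlgebra ℝ V}
    (hw : w ∈ (ExteriorAlgebra.map K.subtype).range) :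
    ∑ i, ι ℝ (f (e i)) * contract (g (e i)) w = extDer f w := by
  obtain ⟨w, rfl⟩ := hw
  change ∑ i, ι ℝ (f (e i)) * contract (g (e i)) (ExteriorAlgebra.map K.subtype w) =
    extDer f (ExteriorAlgebra.map K.subtype w)
  induction w using exteriorAlgebra_left_induction with
  | algebraMap r => simp [contract_algebraMap, extDer_algebraMap]
  | add x y hx hy => simp only [map_add, mul_add, Finset.sum_add_distrib, hx, hy]
  | ι_mul x v hx =>
    have h : ι ℝ (f v) = ∑ i, g (e i) v • ι ℝ (f (e i)) := by
      conv_lhs => rw [he v v.2]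
      simp only [map_sum, map_smul]
    simp only [map_mul, map_apply_ι, extDer_ι_mul, contract_ι_mul, mul_sub,
      Finset.sum_sub_distrib, Submodule.subtype_apply]
    rw [← hx, h, Finset.sum_mul, Finset.mul_sum, sub_eq_add_neg, ← Finset.sum_neg_distrib]
    congr 1
    · refine Finset.sum_congr rfl fun i _ => ?_
      rw [mul_smul_comm, smul_mul_assoc]
    · refine Finset.sum_congr rfl fun i _ => ?_
      rw [← mul_assoc, ← mul_assoc, ← neg_mul]
      congr 1
      exact neg_eq_of_add_eq_zero_left (ι_add_mul_swap _ _)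

theorem mem_range_map_subtype_top (w : ExteriorAlgebra ℝ V) :
    w ∈ (ExteriorAlgebra.map (⊤ : Submodule ℝ V).subtype).range := by
  induction w using exteriorAlgebra_left_induction with
  | algebraMap r => exact algebraMap_mem _ r
  | add x y hx hy => exact add_mem hx hy
  | ι_mul x v hx => exact mul_mem ⟨ι ℝ ⟨v, trivial⟩, by simp⟩ hx

/-- Euler's formula `(k + 1) w = ∑ eᵢ ∧ contract (g eᵢ) w` turns `(k + 1)⟨w, w⟩` into the sum of the
squared norms of the contractions, which have degree `k`. If all of them vanish, the formula gives
`w = 0`. -/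
theorem pairing_pos_of_mem_exteriorPower [FiniteDimensional ℝ V] (hg : ∀ x y, g x y = g y x)
    (hpos : ∀ x, x ≠ 0 → 0 < g x x) (k : ℕ) (w : ExteriorAlgebra ℝ V) (hw : w ∈ ⋀[ℝ]^k V)
    (hw0 : w ≠ 0) : 0 < pairing g w w := by
  obtain ⟨n, e, -, he⟩ := exists_orthonormal_expansion hg hpos ⊤
  induction k generalizing w with
  | zero =>
    rw [exteriorPower, pow_zero, Submodule.mem_one] at hw
    obtain ⟨r, rfl⟩ := hw
    have hr : r ≠ 0 := by
      rintro rfl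
      simp at hw0
    simpa [pairing_algebraMap] using hr
  | succ k ih =>
    have hnn : ∀ i, 0 ≤ pairing g (contract (g (e i)) w) (contract (g (e i)) w) := fun i => by
      rcases eq_or_ne (contract (g (e i)) w) 0 with h | h
      · simp [h]
      · exact (ih _ (contract_mem_exteriorPower _ k hw) h).le
    have hD := sum_ι_mul_contract LinearMap.id e he (mem_range_map_subtype_top w)
    rw [extDer_id_of_mem_exteriorPower _ hw] at hD
    have hsum : ((k + 1 : ℕ) : ℝ) * pairing g w w =
        ∑ i, pairing g (contract (g (e i)) w) (contract (g (e i)) w) := by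
      rw [← smul_eq_mul, ← LinearMap.smul_apply, ← map_smul, ← hD]
      simp only [map_sum, LinearMap.sum_apply, pairing_ι_mul, LinearMap.id_apply]
    have hk : (0 : ℝ) < ((k + 1 : ℕ) : ℝ) := by positivity
    refine pos_of_mul_pos_right (hsum ▸ ?_) hk.le
    refine lt_of_le_of_ne (Finset.sum_nonneg fun i _ => hnn i) fun h => hw0 ?_
    have h0 : ∀ i, contract (g (e i)) w = 0 := fun i => by
      by_contra hc
      exact (ih _ (contract_mem_exteriorPower _ k hw) hc).ne'
        ((Finset.sum_eq_zero_iff_of_nonneg fun i _ => hnn i).mp h.symm i (Finset.mem_univ i))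
    simp only [h0, mul_zero, Finset.sum_const_zero] at hD
    exact (smul_eq_zero.mp hD.symm).resolve_left hk.ne'

/-- The degree operator is self-adjoint, and `u`, `w` are eigenvectors for different eigenvalues. -/
theorem pairing_eq_zero_of_mem_exteriorPower {j k : ℕ} (hjk : j ≠ k)
    {u w : ExteriorAlgebra ℝ V} (hu : u ∈ ⋀[ℝ]^j V) (hw : w ∈ ⋀[ℝ]^k V) :
    pairing g u w = 0 := by
  have h := pairing_extDer (g := g) LinearMap.id LinearMap.id (fun _ _ => rfl) u w
  rw [extDer_id_of_mem_exteriorPower j hu, extDer_id_of_mem_exteriorPower k hw, map_smul,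
    map_smul, LinearMap.smul_apply, smul_eq_mul, smul_eq_mul, ← sub_eq_zero, ← sub_mul] at h
  exact (mul_eq_zero.mp h).resolve_left (sub_ne_zero.mpr (by exact_mod_cast hjk))

theorem pairing_pos [FiniteDimensional ℝ V] (hg : ∀ x y, g x y = g y x)
    (hpos : ∀ x, x ≠ 0 → 0 < g x x) (w : ExteriorAlgebra ℝ V) (hw : w ≠ 0) :
    0 < pairing g w w := by
  classical
  let s := (DirectSum.decompose (fun i : ℕ => ⋀[ℝ]^i V) w).support
  let p : ℕ → ExteriorAlgebra ℝ V := fun i => DirectSum.decompose (fun i : ℕ => ⋀[ℝ]^i V) w i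
  have hp : ∀ i, p i ∈ ⋀[ℝ]^i V := fun i => SetLike.coe_mem _
  have hsum : ∑ i ∈ s, p i = w := DirectSum.sum_support_decompose _ w
  have hww : pairing g w w = ∑ i ∈ s, pairing g (p i) (p i) := by
    rw [← hsum, map_sum]
    refine Finset.sum_congr rfl fun i hi => ?_
    rw [map_sum, LinearMap.sum_apply]
    exact Finset.sum_eq_single_of_mem i hi fun j _ hj =>
      pairing_eq_zero_of_mem_exteriorPower hj (hp j) (hp i)
  have hps : ∀ i ∈ s, 0 < pairing g (p i) (p i) := fun i hi =>
    pairing_pos_of_mem_exteriorPower hg hpos i _ (hp i) (by simpa [s, p] using hi)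
  rw [hww]
  refine Finset.sum_pos hps (Finset.nonempty_iff_ne_empty.mpr fun h => hw ?_)
  rw [← hsum, h, Finset.sum_empty]

end Pairing

/-! ### Complete reducibility for families of operators that are closed under adjoints -/

section Reducibility

variable {M X : Type*} [AddCommGroup M] [Module ℝ M]
  {b : LinearMap.BilinForm ℝ M} {T : X → Module.End ℝ M} {τ : X → X}

/-- Project `w` onto the orthogonal complement of the span `S` of all `T x W`. The component `w'` is
invariant because `b (T x w') (T x w') = -b w' (T (τ x) (T x w'))`, and the last vector lies in `S`.
-/
theorem exists_invariant_add_mem_span [FiniteDimensional ℝ M]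
    (hb : ∀ x y, b x y = b y x) (hpos : ∀ x, x ≠ 0 → 0 < b x x)
    (hT : ∀ x m n, b (T x m) n = -b m (T (τ x) n)) (W : Submodule ℝ M)
    (hW : ∀ x, ∀ w ∈ W, T x w ∈ W) {w : M} (hw : w ∈ W) :
    ∃ w' ∈ W, (∀ x, T x w' = 0) ∧
      ∃ s ∈ Submodule.span ℝ {m | ∃ x, ∃ w ∈ W, m = T x w}, w = w' + s := by
  set S := Submodule.span ℝ {m | ∃ x, ∃ w ∈ W, m = T x w}
  have hSW : S ≤ W := Submodule.span_le.mpr <| by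
    rintro _ ⟨x, w, hw, rfl⟩
    exact hW x w hw
  have hrefl : b.IsRefl := fun x y h => by rw [hb, h]
  have hdisj : Disjoint S (b.orthogonal S) := by
    rw [Submodule.disjoint_def]
    intro x hx hx'
    by_contra h
    exact (hpos x h).ne' (hx' x hx)
  have hsup := ((LinearMap.BilinForm.isCompl_orthogonal_iff_disjoint hrefl).mpr hdisj).sup_eq_top
  obtain ⟨s, hs, w', hw', rfl⟩ := Submodule.mem_sup.mp (hsup ▸ Submodule.mem_top (x := w))
  have hw'W : w' ∈ W := by simpa using sub_mem hw (hSW hs)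
  refine ⟨w', hw'W, fun x => ?_, s, hs, add_comm _ _⟩
  by_contra h
  refine (hpos _ h).ne' ?_
  rw [hT, hb, hw' _ (Submodule.subset_span ⟨τ x, _, hW x _ hw'W, rfl⟩), neg_zero]

theorem eq_zero_of_mem_span_of_invariant
    (hpos : ∀ x, x ≠ 0 → 0 < b x x) (hT : ∀ x m n, b (T x m) n = -b m (T (τ x) n)) {s : M}
    (hs : s ∈ Submodule.span ℝ {m | ∃ x, ∃ w : M, m = T x w}) (hs' : ∀ x, T x s = 0) :
    s = 0 := by
  by_contra h
  refine (hpos s h).ne' ?_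
  suffices hall : ∀ t ∈ Submodule.span ℝ {m | ∃ x, ∃ w : M, m = T x w}, b t s = 0 from hall s hs
  intro t ht
  induction ht using Submodule.span_induction with
  | mem t ht =>
    obtain ⟨x, w, rfl⟩ := ht
    rw [hT, hs', map_zero, neg_zero]
  | zero => simp
  | add x y _ _ hx hy => simp [hx, hy]
  | smul r x _ hx => simp [hx]

end Reducibility

/-! ### The boundary operator of the Lie algebra homology complex -/

section Boundary

open ExteriorAlgebra

variable {L : Type*} [LieRing L] [LieAlgebra ℝ L]

/-- The action of `x : L` on `Λ L` by the derivation that extends `ad x`. -/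
noncomputable def lieDer (x : L) : Module.End ℝ (ExteriorAlgebra ℝ L) :=
  extDer (LieAlgebra.ad ℝ L x : L →ₗ[ℝ] L)

theorem lieDer_ι_mul (x v : L) (w : ExteriorAlgebra ℝ L) :
    lieDer x (ι ℝ v * w) = ι ℝ ⁅x, v⁆ * w + ι ℝ v * lieDer x w :=
  extDer_ι_mul _ _ _

theorem lieDer_algebraMap (x : L) (r : ℝ) : lieDer x (algebraMap ℝ _ r) = 0 :=
  extDer_algebraMap _ _

theorem lieDer_lie (x y : L) (w : ExteriorAlgebra ℝ L) :
    lieDer ⁅x, y⁆ w = lieDer x (lieDer y w) - lieDer y (lieDer x w) := by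
  have h : (LieAlgebra.ad ℝ L ⁅x, y⁆ : L →ₗ[ℝ] L) =
      (LieAlgebra.ad ℝ L x : L →ₗ[ℝ] L) ∘ₗ (LieAlgebra.ad ℝ L y : L →ₗ[ℝ] L) -
        (LieAlgebra.ad ℝ L y : L →ₗ[ℝ] L) ∘ₗ (LieAlgebra.ad ℝ L x : L →ₗ[ℝ] L) := by
    ext z
    simp
  rw [lieDer, lieDer, lieDer, ← extDer_lie, h]

/-- The span of the elements `x · w` for `x : L` and `w : Λ L`. -/
noncomputable def lieDerSpan (L : Type*) [LieRing L] [LieAlgebra ℝ L] :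
    Submodule ℝ (ExteriorAlgebra ℝ L) :=
  Submodule.span ℝ {m | ∃ (x : L) (w : ExteriorAlgebra ℝ L), m = lieDer x w}

/-- `∂` is the boundary operator on `Λ L` that computes the homology of `L`. -/
structure IsBoundary (d : Module.End ℝ (ExteriorAlgebra ℝ L)) : Prop where
  algebraMap : ∀ r : ℝ, d (algebraMap ℝ _ r) = 0
  ι_mul : ∀ (x : L) (w : ExteriorAlgebra ℝ L), d (ι ℝ x * w) = lieDer x w - ι ℝ x * d w
  mem_span : ∀ w, d w ∈ lieDerSpan L

theorem extDer_add (f f' : L →ₗ[ℝ] L) : extDer (f + f') = extDer f + extDer f' := by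
  refine LinearMap.ext fun w => ?_
  induction w using exteriorAlgebra_left_induction with
  | algebraMap r => simp [extDer_algebraMap]
  | add x y hx hy => simp only [map_add, hx, hy]
  | ι_mul x v hx =>
    simp only [LinearMap.add_apply] at hx
    simp only [extDer_ι_mul, LinearMap.add_apply, hx, map_add, add_mul, mul_add]
    abel

theorem extDer_smul (c : ℝ) (f : L →ₗ[ℝ] L) : extDer (c • f) = c • extDer f := by
  refine LinearMap.ext fun w => ?_
  induction w using exteriorAlgebra_left_induction with
  | algebraMap r => simp [extDer_algebraMap]
  | add x y hx hy => simp only [map_add, hx, hy]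
  | ι_mul x v hx =>
    simp only [LinearMap.smul_apply] at hx
    simp only [extDer_ι_mul, LinearMap.smul_apply, hx, map_smul, smul_mul_assoc,
      mul_smul_comm, smul_add]

/-- The linear map `x ↦ lieDer x`. -/
noncomputable def lieDerLin : L →ₗ[ℝ] Module.End ℝ (ExteriorAlgebra ℝ L) where
  toFun := lieDer
  map_add' x y := by
    rw [lieDer, map_add, extDer_add]
    rfl
  map_smul' c x := by
    rw [lieDer, map_smul, extDer_smul]
    rfl

theorem lieDerLin_apply (x : L) : lieDerLin x = lieDer x := rfl

/-- Up to the factor 2 this is the recursion of `IsBoundary.ι_mul`. One copy of `lieDer x w` comes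
from contracting `x`, the other from the brackets `⁅e i, x⁆`. Allowing a subspace `K` lets the
boundary of elements of `ΛK` be computed from a basis of `K` alone. -/
theorem sum_lieDer_contract_ι_mul {g : LinearMap.BilinForm ℝ L} {ι' : Type*} [Fintype ι']
    {K : Submodule ℝ L} (e : ι' → L) (he : ∀ x ∈ K, x = ∑ i, g (e i) x • e i)
    {w : ExteriorAlgebra ℝ L} (hw : w ∈ (ExteriorAlgebra.map K.subtype).range) {x : L}
    (hx : x ∈ K) :
    ∑ i, lieDer (e i) (contract (g (e i)) (ι ℝ x * w)) =
      (2 : ℝ) • lieDer x w - ι ℝ x * ∑ i, lieDer (e i) (contract (g (e i)) w) := by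
  have h1 : ∑ i, g (e i) x • lieDer (e i) w = lieDer x w := by
    conv_rhs => rw [he x hx]
    rw [← lieDerLin_apply, map_sum, LinearMap.sum_apply]
    exact Finset.sum_congr rfl fun i _ => by rw [map_smul]; rfl
  have h2 : ∑ i, ι ℝ ⁅e i, x⁆ * contract (g (e i)) w = -lieDer x w := by
    rw [lieDer, ← sum_ι_mul_contract (LieAlgebra.ad ℝ L x : L →ₗ[ℝ] L) e he hw,
      ← Finset.sum_neg_distrib]
    refine Finset.sum_congr rfl fun i _ => ?_
    rw [← neg_mul, ← map_neg, LieAlgebra.ad_apply, lie_skew]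
  simp only [contract_ι_mul, map_sub, map_smul, lieDer_ι_mul, Finset.sum_sub_distrib,
    Finset.sum_add_distrib, h1, h2, Finset.mul_sum, two_smul]
  abel

theorem exists_isBoundary [FiniteDimensional ℝ L] {g : LinearMap.BilinForm ℝ L}
    (hg : ∀ x y, g x y = g y x) (hpos : ∀ x, x ≠ 0 → 0 < g x x) :
    ∃ d : Module.End ℝ (ExteriorAlgebra ℝ L), IsBoundary d := by
  obtain ⟨n, e, -, he⟩ := exists_orthonormal_expansion hg hpos ⊤
  have hd : ∀ w, ((2⁻¹ : ℝ) • ∑ i, lieDer (e i) ∘ₗ contract (g (e i))) w =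
      (2⁻¹ : ℝ) • ∑ i, lieDer (e i) (contract (g (e i)) w) := fun w => by
    simp [LinearMap.sum_apply]
  refine ⟨(2⁻¹ : ℝ) • ∑ i, lieDer (e i) ∘ₗ contract (g (e i)), fun r => ?_, fun x w => ?_,
    fun w => ?_⟩
  · rw [hd]
    simp [contract_algebraMap]
  · rw [hd, hd, sum_lieDer_contract_ι_mul e he (mem_range_map_subtype_top w) trivial, smul_sub,
      smul_smul, mul_smul_comm]
    norm_num
  · rw [hd]
    exact Submodule.smul_mem _ _ (sum_mem fun i _ => Submodule.subset_span ⟨_, _, rfl⟩)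

namespace IsBoundary

variable {d : Module.End ℝ (ExteriorAlgebra ℝ L)}

theorem lieDer_comm (hd : IsBoundary d) (y : L) (w : ExteriorAlgebra ℝ L) : d (lieDer y w) = lieDer y (d w) := by
  induction w using exteriorAlgebra_left_induction with
  | algebraMap r => simp [lieDer_algebraMap, hd.algebraMap]
  | add a b ha hb => simp only [map_add, ha, hb]
  | ι_mul w x hw =>
    simp only [lieDer_ι_mul, hd.ι_mul, map_add, map_sub, hw, lieDer_lie]
    abel

theorem map_neg (hd : IsBoundary d) (w : ExteriorAlgebra ℝ L) :
    ExteriorAlgebra.map (-LinearMap.id) (d w) = -d (ExteriorAlgebra.map (-LinearMap.id) w) := by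
  induction w using exteriorAlgebra_left_induction with
  | algebraMap r => simp [hd.algebraMap]
  | add a b ha hb => simp only [map_add, ha, hb, neg_add]
  | ι_mul w x hw =>
    have h : ExteriorAlgebra.map (-LinearMap.id) (lieDer x w) =
        lieDer x (ExteriorAlgebra.map (-LinearMap.id) w) :=
      map_extDer _ _ _ (by simp) w
    simp only [hd.ι_mul, map_sub, map_mul, map_apply_ι, hw, h, LinearMap.neg_apply,
      LinearMap.id_apply, _root_.map_neg, neg_mul, mul_neg]
    abel

variable {H : Type*} [LieRing H] [LieAlgebra ℝ H] (φ : H →ₗ⁅ℝ⁆ L)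

/-- The boundary operator is a graded derivation on products `u ∧ w` such that `u` lies in the
exterior algebra of a subalgebra under which `w` is invariant. -/
theorem map_mul_of_invariant (hd : IsBoundary d) {b : ExteriorAlgebra ℝ L}
    (hb : ∀ x : H, lieDer (φ x) b = 0)
    (w : ExteriorAlgebra ℝ H) :
    d (ExteriorAlgebra.map (φ : H →ₗ[ℝ] L) w * b) =
      d (ExteriorAlgebra.map (φ : H →ₗ[ℝ] L) w) * b +
        ExteriorAlgebra.map (-LinearMap.id) (ExteriorAlgebra.map (φ : H →ₗ[ℝ] L) w) * d b := by
  induction w using exteriorAlgebra_left_induction with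
  | algebraMap r =>
    simp only [AlgHom.commutes, ← Algebra.smul_def, map_smul, hd.algebraMap, zero_mul, zero_add]
  | add u v hu hv => simp only [map_add, add_mul, hu, hv]; abel
  | ι_mul w x hw =>
    have h : ∀ u : ExteriorAlgebra ℝ L, lieDer (φ x) (u * b) = lieDer (φ x) u * b := fun u => by
      have := extDer_mul (LieAlgebra.ad ℝ L (φ x) : L →ₗ[ℝ] L) u b
      change lieDer (φ x) (u * b) = lieDer (φ x) u * b + u * lieDer (φ x) b at this
      rw [this, hb, mul_zero, add_zero]
    have h1 : ExteriorAlgebra.map (φ : H →ₗ[ℝ] L) (ι ℝ x * w) =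
        ι ℝ (φ x) * ExteriorAlgebra.map (φ : H →ₗ[ℝ] L) w := by simp
    have h2 : ∀ u : ExteriorAlgebra ℝ L, ExteriorAlgebra.map (-LinearMap.id) (ι ℝ (φ x) * u) =
        -(ι ℝ (φ x) * ExteriorAlgebra.map (-LinearMap.id) u) := fun u => by simp
    rw [h1, mul_assoc, hd.ι_mul, hd.ι_mul, h, hw, h2, sub_mul, mul_add, neg_mul, mul_assoc,
      mul_assoc]
    abel

theorem eq_zero_of_invariant_form (hd : IsBoundary d)
    {α : Module.Dual ℝ (ExteriorAlgebra ℝ L)}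
    (hα : ∀ (x : L) (w : ExteriorAlgebra ℝ L), α (lieDer x w) = 0) (w : ExteriorAlgebra ℝ L) :
    α (d w) = 0 := by
  have h : lieDerSpan L ≤ LinearMap.ker α := Submodule.span_le.mpr <| by
    rintro _ ⟨x, u, rfl⟩
    exact hα x u
  exact h (hd.mem_span w)

theorem lieDer_map (x : H) (w : ExteriorAlgebra ℝ H) :
    lieDer (φ x) (ExteriorAlgebra.map (φ : H →ₗ[ℝ] L) w) =
      ExteriorAlgebra.map (φ : H →ₗ[ℝ] L) (lieDer x w) :=
  (map_extDer _ _ _ (fun v => LieHom.map_lie φ x v) w).symm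

/-- If a subalgebra is stable under the adjoints of its elements, then the invariants of its
exterior algebra are cycles. -/
theorem eq_zero_of_invariant (hd : IsBoundary d) {g : LinearMap.BilinForm ℝ L}
    (hg : ∀ x y, g x y = g y x) (hpos : ∀ x, x ≠ 0 → 0 < g x x) [FiniteDimensional ℝ L]
    {θ : L → L} (hθ : ∀ x y, g (θ x) y = g x (θ y))
    (hadj : ∀ x y z, g ⁅x, y⁆ z = -g y ⁅θ x, z⁆) (hφ : ∀ x : H, ∃ y, θ (φ x) = φ y)
    {u : ExteriorAlgebra ℝ H} (hu : ∀ x : H, lieDer x u = 0) :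
    d (ExteriorAlgebra.map (φ : H →ₗ[ℝ] L) u) = 0 := by
  set K : Submodule ℝ L := LinearMap.range (φ : H →ₗ[ℝ] L)
  obtain ⟨n, e, heK, he⟩ := exists_orthonormal_expansion hg hpos K
  have hrange : ∀ w : ExteriorAlgebra ℝ H, ExteriorAlgebra.map (φ : H →ₗ[ℝ] L) w ∈
      (ExteriorAlgebra.map K.subtype).range := fun w => by
    refine ⟨ExteriorAlgebra.map (φ : H →ₗ[ℝ] L).rangeRestrict w, ?_⟩
    change ((ExteriorAlgebra.map K.subtype).comp
      (ExteriorAlgebra.map (φ : H →ₗ[ℝ] L).rangeRestrict)) w = _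
    rw [ExteriorAlgebra.map_comp_map]
    rfl
  -- On the exterior algebra of the image, the boundary operator is given by an orthonormal basis of
  -- the image.
  have h2 : ∀ w : ExteriorAlgebra ℝ H,
      ∑ i, lieDer (e i) (contract (g (e i)) (ExteriorAlgebra.map (φ : H →ₗ[ℝ] L) w)) =
        (2 : ℝ) • d (ExteriorAlgebra.map (φ : H →ₗ[ℝ] L) w) := fun w => by
    induction w using exteriorAlgebra_left_induction with
    | algebraMap r => simp [contract_algebraMap, hd.algebraMap]
    | add a b ha hb => simp only [map_add, Finset.sum_add_distrib, ha, hb, smul_add]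
    | ι_mul w x hw =>
      rw [map_mul, map_apply_ι, sum_lieDer_contract_ι_mul e he (hrange w) ⟨x, rfl⟩, hw,
        hd.ι_mul, smul_sub, mul_smul_comm]
  have hθe : ∀ i, θ (e i) = ∑ j, g (e j) (θ (e i)) • e j := fun i => by
    obtain ⟨x, hx⟩ := heK i
    obtain ⟨y, hy⟩ := hφ x
    refine he _ ⟨y, ?_⟩
    rw [← hx]
    exact hy.symm
  -- Stability of the image under `θ` gives `θ` a symmetric matrix in the basis `e`; summed against
  -- the antisymmetric bracket it yields zero.
  have hsum : ∑ i, ⁅θ (e i), e i⁆ = 0 := by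
    have h : ∑ i, ⁅θ (e i), e i⁆ = ∑ i, ∑ j, g (e j) (θ (e i)) • ⁅e j, e i⁆ := by
      refine Finset.sum_congr rfl fun i _ => ?_
      conv_lhs => rw [hθe i]
      rw [sum_lie]
      simp only [smul_lie]
    have h' : ∑ i, ⁅θ (e i), e i⁆ = -∑ i, ⁅θ (e i), e i⁆ := by
      rw [h]
      conv_lhs => rw [Finset.sum_comm]
      rw [← Finset.sum_neg_distrib]
      refine Finset.sum_congr rfl fun i _ => ?_
      rw [← Finset.sum_neg_distrib]
      refine Finset.sum_congr rfl fun j _ => ?_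
      rw [← smul_neg, lie_skew, hg, hθ]
    have h'' : (2 : ℝ) • ∑ i, ⁅θ (e i), e i⁆ = 0 := by
      rw [two_smul]
      exact add_eq_zero_iff_eq_neg.mpr h'
    exact (smul_eq_zero.mp h'').resolve_left two_ne_zero
  have h0 : ∀ i, lieDer (e i) (ExteriorAlgebra.map (φ : H →ₗ[ℝ] L) u) = 0 := fun i => by
    obtain ⟨x, hx⟩ := heK i
    rw [← hx, LieHom.coe_toLinearMap, lieDer_map, hu, map_zero]
  -- By invariance of `u` only the commutator of the two operators survives, and it is a
  -- contraction.
  have h3 : ∀ i, lieDer (e i) (contract (g (e i)) (ExteriorAlgebra.map (φ : H →ₗ[ℝ] L) u)) =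
      contract (g ⁅θ (e i), e i⁆) (ExteriorAlgebra.map (φ : H →ₗ[ℝ] L) u) := fun i => by
    have h := contract_extDer (g (e i)) (LieAlgebra.ad ℝ L (e i) : L →ₗ[ℝ] L)
      (ExteriorAlgebra.map (φ : H →ₗ[ℝ] L) u)
    change contract (g (e i)) (lieDer (e i) _) = lieDer (e i) _ + _ at h
    have hc : g (e i) ∘ₗ (LieAlgebra.ad ℝ L (e i) : L →ₗ[ℝ] L) = -g ⁅θ (e i), e i⁆ := by
      ext y
      change g (e i) ⁅e i, y⁆ = -g ⁅θ (e i), e i⁆ y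
      rw [hg, hadj, hg]
    rw [h0, map_zero, hc, _root_.map_neg, LinearMap.neg_apply] at h
    exact eq_of_sub_eq_zero (by rw [sub_eq_add_neg]; exact h.symm)
  have h4 := h2 u
  simp only [h3] at h4
  rw [← LinearMap.sum_apply, ← map_sum, ← map_sum, hsum, map_zero, map_zero,
    LinearMap.zero_apply] at h4
  exact (smul_eq_zero.mp h4.symm).resolve_left two_ne_zero

end IsBoundary

end Boundary

/-! ### Restriction of primitive elements -/

section Restriction

open ExteriorAlgebra

variable {L : Type*} [LieRing L] [LieAlgebra ℝ L] [FiniteDimensional ℝ L]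
  {H : Type*} [LieRing H] [LieAlgebra ℝ H] {θ : L →ₗ⁅ℝ⁆ L}

/-- Pulling back forms along a homomorphism whose image is stable under a Cartan involution
carries primitive elements to primitive elements. -/
theorem IsCartanInvolution.comp_map_mem_primitive (hθ : IsCartanInvolution θ) (φ : H →ₗ⁅ℝ⁆ L)
    (hφ : ∀ x : H, ∃ y, θ (φ x) = φ y) {α : Module.Dual ℝ (ExteriorAlgebra ℝ L)}
    (hα : α ∈ primitive L) :
    α ∘ₗ (ExteriorAlgebra.map (φ : H →ₗ[ℝ] L)).toLinearMap ∈ primitive H := by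
  obtain ⟨B, hsymm, hinv, hBθ, hneg⟩ := hθ.exists_form
  obtain ⟨hα1, hαinv, hαmul⟩ := hα
  change ∀ x w, α (lieDer x w) = 0 at hαinv
  let g : LinearMap.BilinForm ℝ L := -B.compl₂ (θ : L →ₗ[ℝ] L)
  have hgB : ∀ x y, g x y = -B x (θ y) := fun x y => rfl
  have hg : ∀ x y, g x y = g y x := fun x y => by
    rw [hgB, hgB, ← hBθ, hθ.involutive, hsymm]
  have hpos : ∀ x, x ≠ 0 → 0 < g x x := fun x hx => by
    rw [hgB]
    exact neg_pos.mpr (hneg x hx)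
  have hgθ : ∀ x y, g (θ x) y = g x (θ y) := fun x y => by
    rw [hgB, hgB, hBθ, hθ.involutive]
  have hadj : ∀ x y z, g ⁅x, y⁆ z = -g y ⁅θ x, z⁆ := fun x y z => by
    rw [hgB, hgB, LieHom.map_lie, hθ.involutive, ← lie_skew, ← hinv, map_neg,
      LinearMap.neg_apply]
  have hpsymm := pairing_comm hg
  have hppos := pairing_pos hg hpos
  have hpadj : ∀ x m n, pairing g (lieDer x m) n = -pairing g m (lieDer (θ x) n) :=
    fun x m n => by
      have h : ∀ y z, g ((LieAlgebra.ad ℝ L x : L →ₗ[ℝ] L) y) z =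
          g y (((-1 : ℝ) • (LieAlgebra.ad ℝ L (θ x) : L →ₗ[ℝ] L)) z) := fun y z => by
        change g ⁅x, y⁆ z = g y ((-1 : ℝ) • ⁅θ x, z⁆)
        rw [hadj, map_smul, smul_eq_mul, neg_one_mul]
      rw [lieDer, pairing_extDer _ _ h, extDer_smul, LinearMap.smul_apply, map_smul, smul_eq_mul,
        neg_one_mul]
      rfl
  obtain ⟨d, hd⟩ := exists_isBoundary hg hpos
  set Φ := ExteriorAlgebra.map (φ : H →ₗ[ℝ] L)
  have hclosed : ∀ u : ExteriorAlgebra ℝ H, (∀ x, lieDer x u = 0) → d (Φ u) = 0 :=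
    fun u hu => hd.eq_zero_of_invariant φ hg hpos hgθ hadj hφ hu
  -- every cycle is homologous to an invariant
  have hdecomp : ∀ w, d w = 0 → ∃ w' a, (∀ x : L, lieDer x w' = 0) ∧ d w' = 0 ∧ w = w' + d a := by
    intro w hw
    obtain ⟨w', hw', hinv', s, hs, rfl⟩ := exists_invariant_add_mem_span hpsymm hppos hpadj
      (LinearMap.ker d) (fun x w hw => by
        rw [LinearMap.mem_ker] at hw ⊢
        rw [hd.lieDer_comm, hw, map_zero]) hw
    have hle : Submodule.span ℝ {m | ∃ x, ∃ w ∈ LinearMap.ker d, m = lieDer x w} ≤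
        LinearMap.range d := Submodule.span_le.mpr <| by
      rintro _ ⟨x, w, hw, rfl⟩
      -- Cartan's formula `∂(x ∧ w) + x ∧ ∂w = x · w`: the action on cycles is homologically
      -- trivial.
      refine ⟨ι ℝ x * w, ?_⟩
      rw [hd.ι_mul, LinearMap.mem_ker.mp hw, mul_zero, sub_zero]
    obtain ⟨a, rfl⟩ := hle hs
    exact ⟨w', a, hinv', hw', rfl⟩
  -- a boundary that is invariant under `H` is the boundary of an element invariant under `H`
  have hinvb : ∀ b, (∀ x : H, lieDer (φ x) (d b) = 0) →
      ∃ b', (∀ x : H, lieDer (φ x) b' = 0) ∧ d b' = d b := by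
    intro b hb
    choose τ hτ using hφ
    have hadjH : ∀ (x : H) m n, pairing g (lieDer (φ x) m) n =
        -pairing g m (lieDer (φ (τ x)) n) := fun x m n => by rw [hpadj, hτ]
    obtain ⟨b', -, hb', s, hs, rfl⟩ := exists_invariant_add_mem_span
      (T := fun x : H => lieDer (φ x)) hpsymm hppos hadjH ⊤ (fun _ _ _ => trivial)
      (Submodule.mem_top (x := b))
    refine ⟨b', hb', ?_⟩
    -- `d s` is a sum of elements `x · m` with `x` in `H`, since `d` commutes with the action, and
    -- is also `H`-invariant. These two spaces are orthogonal.
    suffices h : d s = 0 by rw [map_add, h, add_zero]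
    refine eq_zero_of_mem_span_of_invariant (T := fun x : H => lieDer (φ x)) hppos hadjH ?_ ?_
    · have hle : Submodule.span ℝ {m | ∃ x : H, ∃ w ∈ (⊤ : Submodule ℝ (ExteriorAlgebra ℝ L)),
          m = lieDer (φ x) w} ≤ (Submodule.span ℝ {m | ∃ (x : H) (w : ExteriorAlgebra ℝ L),
          m = lieDer (φ x) w}).comap d := Submodule.span_le.mpr <| by
        rintro _ ⟨x, w, -, rfl⟩
        exact Submodule.subset_span ⟨x, d w, hd.lieDer_comm _ _⟩
      exact hle hs
    · intro x
      have h := hb x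
      rw [map_add, map_add, ← hd.lieDer_comm (φ x) b', hb', map_zero, zero_add] at h
      exact h
  -- Projection to degree 0 is itself an invariant form. Hence changing a cycle by a boundary keeps
  -- its scalar part zero.
  have hdeg : ∀ a, algebraMapInv (d a) = 0 :=
    hd.eq_zero_of_invariant_form (α := algebraMapInv.toLinearMap)
      fun x w => algebraMapInv_extDer _ w
  have hpi : ∀ w w' a, algebraMapInv w = 0 → (∀ x : L, lieDer x w' = 0) → w = w' + d a →
      w' ∈ posInvariants L := fun w w' a hw hw' h => by
    refine ⟨?_, hw'⟩
    rw [h, map_add, hdeg, add_zero] at hw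
    exact hw
  refine ⟨by simpa using hα1, fun x w => ?_, fun u hu w hw => ?_⟩
  · change α (Φ (lieDer x w)) = 0
    rw [← IsBoundary.lieDer_map, hαinv]
  · obtain ⟨hu0, hu⟩ := hu
    obtain ⟨hw0, hw⟩ := hw
    change ∀ x, lieDer x u = 0 at hu
    change ∀ x, lieDer x w = 0 at hw
    change α (Φ (u * w)) = 0
    obtain ⟨u', a, hu', -, hua⟩ := hdecomp _ (hclosed u hu)
    obtain ⟨w', b, hw', hdw', hwb⟩ := hdecomp _ (hclosed w hw)
    have hu'p := hpi _ u' a (by rw [algebraMapInv_map, hu0]) hu' hua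
    have hw'p := hpi _ w' b (by rw [algebraMapInv_map, hw0]) hw' hwb
    have hw_inv : ∀ x : H, lieDer (φ x) (d b) = 0 := fun x => by
      have h : lieDer (φ x) (Φ w) = 0 := by rw [IsBoundary.lieDer_map, hw, map_zero]
      rwa [hwb, map_add, hw', zero_add] at h
    obtain ⟨b', hb', hdb'⟩ := hinvb b hw_inv
    -- The product rule carries the sign involution on its first factor, so it is applied to the
    -- image of `u` under that involution, which is again invariant.
    have h1 : α (Φ u * d b) = 0 := by
      have hε : Φ (ExteriorAlgebra.map (-LinearMap.id) u) =
          ExteriorAlgebra.map (-LinearMap.id) (Φ u) := by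
        rw [← AlgHom.comp_apply, ← AlgHom.comp_apply, ExteriorAlgebra.map_comp_map,
          ExteriorAlgebra.map_comp_map]
        congr 2
        ext x
        simp
      have hεu : ∀ x, lieDer x (ExteriorAlgebra.map (-LinearMap.id) u) = 0 := fun x => by
        have := map_extDer (-LinearMap.id) (LieAlgebra.ad ℝ H x : H →ₗ[ℝ] H)
          (LieAlgebra.ad ℝ H x : H →ₗ[ℝ] H) (by simp) u
        rw [lieDer, ← this]
        change ExteriorAlgebra.map (-LinearMap.id) (lieDer x u) = 0
        rw [hu, map_zero]
      have hεε : ExteriorAlgebra.map (-LinearMap.id)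
          (ExteriorAlgebra.map (-LinearMap.id) (Φ u)) = Φ u := by
        rw [← AlgHom.comp_apply, ExteriorAlgebra.map_comp_map]
        have h : (-LinearMap.id : L →ₗ[ℝ] L) ∘ₗ (-LinearMap.id) = LinearMap.id := by
          ext x
          simp
        rw [h, ExteriorAlgebra.map_id, AlgHom.id_apply]
      have h := hd.map_mul_of_invariant φ hb' (ExteriorAlgebra.map (-LinearMap.id) u)
      rw [hclosed _ hεu, zero_mul, zero_add, hε, hεε, hdb'] at h
      rw [← h]
      exact hd.eq_zero_of_invariant_form hαinv _
    have h2 : α (d a * w') = 0 := by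
      have h := hd.map_mul_of_invariant (LieHom.id : L →ₗ⁅ℝ⁆ L) (b := w') hw' a
      have hid : ExteriorAlgebra.map ((LieHom.id : L →ₗ⁅ℝ⁆ L) : L →ₗ[ℝ] L) =
        AlgHom.id ℝ _ := ExteriorAlgebra.map_id
      rw [hid, hdw', mul_zero, add_zero, AlgHom.id_apply] at h
      rw [← h]
      exact hd.eq_zero_of_invariant_form hαinv _
    rw [map_mul, hwb, mul_add, map_add, h1, add_zero, hua, add_mul, map_add, h2, add_zero]
    exact hαmul u' hu'p w' hw'p

/-- Pulling back forms along a homomorphism that intertwines a linear map with a Cartan involution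
preserves the `(-1)`-eigenspaces in the spaces of primitive elements. -/
theorem IsCartanInvolution.comp_map_mem_primitiveAnti (hθ : IsCartanInvolution θ)
    (φ : H →ₗ⁅ℝ⁆ L) {θ' : H →ₗ[ℝ] H} (hφ : ∀ x : H, θ (φ x) = φ (θ' x))
    {α : Module.Dual ℝ (ExteriorAlgebra ℝ L)} (hα : α ∈ primitiveAnti (θ : L →ₗ[ℝ] L)) :
    α ∘ₗ (ExteriorAlgebra.map (φ : H →ₗ[ℝ] L)).toLinearMap ∈ primitiveAnti θ' := by
  refine ⟨hθ.comp_map_mem_primitive φ (fun x => ⟨_, hφ x⟩) hα.1, fun w => ?_⟩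
  have h : ExteriorAlgebra.map (φ : H →ₗ[ℝ] L) (ExteriorAlgebra.map θ' w) =
      ExteriorAlgebra.map (θ : L →ₗ[ℝ] L) (ExteriorAlgebra.map (φ : H →ₗ[ℝ] L) w) := by
    rw [← AlgHom.comp_apply, ← AlgHom.comp_apply, ExteriorAlgebra.map_comp_map,
      ExteriorAlgebra.map_comp_map]
    congr 2
    ext x
    exact (hφ x).symm
  change α (ExteriorAlgebra.map (φ : H →ₗ[ℝ] L) (ExteriorAlgebra.map θ' w)) = _
  rw [h, hα.2]
  rfl

theorem ReductivePair.restWellDefined (P : ReductivePair L) : P.RestWellDefined :=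
  fun _ hα => P.cartan.comp_map_mem_primitiveAnti P.H.incl (fun _ => rfl) hα

end Restriction

/-! ### Extension of primitive elements to the complexification

The map `β ↦ Re (β_ℂ)` extends a primitive element from `H` to `ℂ ⊗ H`, seen as a real Lie algebra.
A preimage of the extension under restriction from `ℂ ⊗ L`, pulled back to `L`, restricts to `β`. -/

section Complexification

open ExteriorAlgebra

/-- The real part `ℂ ⊗ M → M`. -/
noncomputable def rePart (M : Type*) [AddCommGroup M] [Module ℝ M] : ℂ ⊗[ℝ] M →ₗ[ℝ] M :=
  (TensorProduct.lid ℝ M).toLinearMap ∘ₗ Complex.reLm.rTensor M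

/-- The imaginary part `ℂ ⊗ M → M`. -/
noncomputable def imPart (M : Type*) [AddCommGroup M] [Module ℝ M] : ℂ ⊗[ℝ] M →ₗ[ℝ] M :=
  (TensorProduct.lid ℝ M).toLinearMap ∘ₗ Complex.imLm.rTensor M

section Module

variable {M N : Type*} [AddCommGroup M] [Module ℝ M] [AddCommGroup N] [Module ℝ N]

@[simp]
theorem rePart_tmul (z : ℂ) (m : M) : rePart M (z ⊗ₜ m) = z.re • m := by
  simp [rePart]

@[simp]
theorem imPart_tmul (z : ℂ) (m : M) : imPart M (z ⊗ₜ m) = z.im • m := by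
  simp [imPart]

theorem rePart_lTensor (f : M →ₗ[ℝ] N) (m : ℂ ⊗[ℝ] M) :
    rePart N (f.lTensor ℂ m) = f (rePart M m) := by
  induction m with
  | zero => simp
  | tmul z x => simp
  | add a b ha hb => simp only [map_add, ha, hb]

theorem imPart_lTensor (f : M →ₗ[ℝ] N) (m : ℂ ⊗[ℝ] M) :
    imPart N (f.lTensor ℂ m) = f (imPart M m) := by
  induction m with
  | zero => simp
  | tmul z x => simp
  | add a b ha hb => simp only [map_add, ha, hb]

theorem rePart_mul {A : Type*} [Ring A] [Algebra ℝ A] (a b : ℂ ⊗[ℝ] A) :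
    rePart A (a * b) = rePart A a * rePart A b - imPart A a * imPart A b := by
  induction a with
  | zero => simp
  | add a a' ha ha' => simp only [add_mul, map_add, ha, ha']; abel
  | tmul z x =>
    induction b with
    | zero => simp
    | add b b' hb hb' => simp only [mul_add, map_add, hb, hb']; abel
    | tmul z' y => simp only [Algebra.TensorProduct.tmul_mul_tmul, rePart_tmul, imPart_tmul,
        Complex.mul_re, sub_smul, smul_mul_smul_comm]

theorem imPart_mul {A : Type*} [Ring A] [Algebra ℝ A] (a b : ℂ ⊗[ℝ] A) :
    imPart A (a * b) = rePart A a * imPart A b + imPart A a * rePart A b := by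
  induction a with
  | zero => simp
  | add a a' ha ha' => simp only [add_mul, map_add, ha, ha']; abel
  | tmul z x =>
    induction b with
    | zero => simp
    | add b b' hb hb' => simp only [mul_add, map_add, hb, hb']; abel
    | tmul z' y => simp only [Algebra.TensorProduct.tmul_mul_tmul, rePart_tmul, imPart_tmul,
        Complex.mul_im, add_smul, smul_mul_smul_comm]

end Module

section Linear

variable {V : Type*} [AddCommGroup V] [Module ℝ V]

/-- For sums of pure tensors the cross terms must cancel as well, so anticommutation is proved
first. -/
theorem lTensor_ι_mul_self (v : ℂ ⊗[ℝ] V) :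
    (ι ℝ : V →ₗ[ℝ] _).lTensor ℂ v * (ι ℝ : V →ₗ[ℝ] _).lTensor ℂ v = 0 := by
  have hanti : ∀ (z : ℂ) (x : V) (w : ℂ ⊗[ℝ] V),
      (z ⊗ₜ[ℝ] ι ℝ x) * (ι ℝ : V →ₗ[ℝ] _).lTensor ℂ w +
        (ι ℝ : V →ₗ[ℝ] _).lTensor ℂ w * (z ⊗ₜ[ℝ] ι ℝ x) = 0 := by
    intro z x w
    induction w with
    | zero => simp
    | add a b ha hb =>
      rw [map_add, mul_add, add_mul, add_add_add_comm, ha, hb, add_zero]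
    | tmul z' y =>
      rw [LinearMap.lTensor_tmul, Algebra.TensorProduct.tmul_mul_tmul,
        Algebra.TensorProduct.tmul_mul_tmul, mul_comm z' z, ← TensorProduct.tmul_add,
        ι_add_mul_swap, TensorProduct.tmul_zero]
  induction v with
  | zero => simp
  | tmul z x => simp
  | add a b ha hb =>
    have hab : (ι ℝ : V →ₗ[ℝ] _).lTensor ℂ a * (ι ℝ : V →ₗ[ℝ] _).lTensor ℂ b +
        (ι ℝ : V →ₗ[ℝ] _).lTensor ℂ b * (ι ℝ : V →ₗ[ℝ] _).lTensor ℂ a = 0 := by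
      clear ha
      induction a with
      | zero => simp
      | tmul z x => exact hanti z x b
      | add a a' h h' => rw [map_add, mul_add, add_mul, add_add_add_comm, h, h', add_zero]
    rw [map_add, add_mul, mul_add, mul_add, ha, hb, zero_add, add_zero, hab]

/-- The canonical homomorphism from the real exterior algebra of `ℂ ⊗ V` to `ℂ ⊗ Λ V`, the complex
exterior algebra of `ℂ ⊗ V`. -/
noncomputable def complexExterior : ExteriorAlgebra ℝ (ℂ ⊗[ℝ] V) →ₐ[ℝ] ℂ ⊗[ℝ] ExteriorAlgebra ℝ V :=
  ExteriorAlgebra.lift ℝ ⟨(ι ℝ).lTensor ℂ, lTensor_ι_mul_self⟩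

theorem complexExterior_ι (v : ℂ ⊗[ℝ] V) :
    complexExterior (ι ℝ v) = (ι ℝ : V →ₗ[ℝ] _).lTensor ℂ v := by
  simp [complexExterior]

theorem algebraMapInv_complexExterior (w : ExteriorAlgebra ℝ (ℂ ⊗[ℝ] V)) :
    algebraMapInv (rePart _ (complexExterior w)) = algebraMapInv w ∧
      algebraMapInv (imPart _ (complexExterior w)) = 0 := by
  induction w using exteriorAlgebra_left_induction with
  | algebraMap r =>
    rw [AlgHom.commutes, Algebra.TensorProduct.algebraMap_apply]
    simp [algebraMapInv]
  | add a b ha hb => simp [ha.1, ha.2, hb.1, hb.2]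
  | ι_mul w v hw =>
    rw [map_mul, complexExterior_ι, rePart_mul, imPart_mul, rePart_lTensor, imPart_lTensor]
    simp [algebraMapInv]

theorem complexExterior_map (f : V →ₗ[ℝ] V) (w : ExteriorAlgebra ℝ (ℂ ⊗[ℝ] V)) :
    complexExterior (ExteriorAlgebra.map
        (TensorProduct.map Complex.conjAe.toAlgHom.toLinearMap f) w) =
      Algebra.TensorProduct.map Complex.conjAe.toAlgHom (ExteriorAlgebra.map f)
        (complexExterior w) := by
  induction w using exteriorAlgebra_left_induction with
  | algebraMap r => simp only [AlgHom.commutes]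
  | add a b ha hb => simp only [map_add, ha, hb]
  | ι_mul w v hw =>
    rw [map_mul, map_mul, map_mul, map_mul, hw, map_apply_ι, complexExterior_ι,
      complexExterior_ι]
    congr 1
    induction v with
    | zero => simp
    | tmul z x => simp
    | add a b ha hb => simp only [map_add, ha, hb]

theorem complexExterior_map_one_tmul (w : ExteriorAlgebra ℝ V) :
    complexExterior (ExteriorAlgebra.map (TensorProduct.mk ℝ ℂ V 1) w) = 1 ⊗ₜ w := by
  induction w using exteriorAlgebra_left_induction with
  | algebraMap r =>
    rw [AlgHom.commutes, AlgHom.commutes, Algebra.TensorProduct.algebraMap_apply']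
  | add a b ha hb => simp only [map_add, ha, hb, TensorProduct.tmul_add]
  | ι_mul w v hw =>
    rw [map_mul, map_mul, hw, map_apply_ι, complexExterior_ι]
    simp

/-- The real part of the complex multilinear extension of a form on `V` to `ℂ ⊗ V`. -/
noncomputable def reExtension (β : Module.Dual ℝ (ExteriorAlgebra ℝ V)) :
    Module.Dual ℝ (ExteriorAlgebra ℝ (ℂ ⊗[ℝ] V)) :=
  β ∘ₗ rePart _ ∘ₗ complexExterior.toLinearMap

theorem reExtension_apply (β : Module.Dual ℝ (ExteriorAlgebra ℝ V))
    (w : ExteriorAlgebra ℝ (ℂ ⊗[ℝ] V)) :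
    reExtension β w = β (rePart _ (complexExterior w)) := rfl

end Linear

variable {H : Type*} [LieRing H] [LieAlgebra ℝ H]

/-- Both sides are derivations along `complexExterior` (for the right one this uses that `ℂ` is
commutative), so comparing them on generators suffices. -/
theorem complexExterior_lieDer (z : ℂ) (x : H) (w : ExteriorAlgebra ℝ (ℂ ⊗[ℝ] H)) :
    complexExterior (lieDer (z ⊗ₜ[ℝ] x) w) =
      TensorProduct.map (LinearMap.mulLeft ℝ z) (lieDer x) (complexExterior w) := by
  have hder : ∀ a b : ℂ ⊗[ℝ] ExteriorAlgebra ℝ H,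
      TensorProduct.map (LinearMap.mulLeft ℝ z) (lieDer x) (a * b) =
        TensorProduct.map (LinearMap.mulLeft ℝ z) (lieDer x) a * b +
          a * TensorProduct.map (LinearMap.mulLeft ℝ z) (lieDer x) b := by
    intro a b
    induction a with
    | zero => simp
    | add a a' ha ha' => simp only [add_mul, map_add, ha, ha']; abel
    | tmul s u =>
      induction b with
      | zero => simp
      | add b b' hb hb' => simp only [mul_add, map_add, hb, hb']; abel
      | tmul t v =>
        have h : lieDer x (u * v) = lieDer x u * v + u * lieDer x v := extDer_mul _ _ _
        simp only [Algebra.TensorProduct.tmul_mul_tmul, TensorProduct.map_tmul,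
          LinearMap.mulLeft_apply, h, TensorProduct.tmul_add, mul_assoc, mul_left_comm s z t]
  induction w using exteriorAlgebra_left_induction with
  | algebraMap r =>
    rw [lieDer_algebraMap, AlgHom.commutes, Algebra.TensorProduct.algebraMap_apply]
    have h1 : lieDer x (1 : ExteriorAlgebra ℝ H) = 0 := extDer_one _
    simp [h1]
  | add a b ha hb => simp only [map_add, ha, hb]
  | ι_mul w v hw =>
    rw [lieDer_ι_mul, map_add, map_mul, map_mul, map_mul, hw, hder, complexExterior_ι,
      complexExterior_ι]
    congr 2
    induction v with
    | zero => simp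
    | add a b ha hb => simp only [lie_add, map_add, ha, hb]
    | tmul t y =>
      have h : lieDer x (ι ℝ y) = ι ℝ ⁅x, y⁆ := extDer_ι _ _
      simp [h]

/-- Invariance under the elements `1 ⊗ x` is enough: they act through real operators, which commute
with taking real and imaginary parts. -/
theorem complexExterior_invariant {u : ExteriorAlgebra ℝ (ℂ ⊗[ℝ] H)}
    (hu : u ∈ posInvariants (ℂ ⊗[ℝ] H)) :
    rePart _ (complexExterior u) ∈ posInvariants H ∧
      imPart _ (complexExterior u) ∈ posInvariants H := by
  obtain ⟨hu0, hu⟩ := hu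
  change ∀ x, lieDer x u = 0 at hu
  have h : ∀ x : H, (lieDer x).lTensor ℂ (complexExterior u) = 0 := fun x => by
    have h1 := complexExterior_lieDer 1 x u
    rw [hu, map_zero, LinearMap.mulLeft_one] at h1
    exact h1.symm
  refine ⟨⟨by rw [(algebraMapInv_complexExterior u).1, hu0], fun x => ?_⟩,
    ⟨(algebraMapInv_complexExterior u).2, fun x => ?_⟩⟩
  · change lieDer x _ = 0
    rw [← rePart_lTensor, h, map_zero]
  · change lieDer x _ = 0
    rw [← imPart_lTensor, h, map_zero]

theorem reExtension_mem_primitive {β : Module.Dual ℝ (ExteriorAlgebra ℝ H)}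
    (hβ : β ∈ primitive H) : reExtension β ∈ primitive (ℂ ⊗[ℝ] H) := by
  obtain ⟨hβ1, hβinv, hβmul⟩ := hβ
  refine ⟨?_, fun X w => ?_, fun u hu w hw => ?_⟩
  · rw [reExtension_apply, map_one, Algebra.TensorProduct.one_def]
    simpa using hβ1
  · change reExtension β (lieDer X w) = 0
    induction X with
    | zero => rw [← lieDerLin_apply, map_zero, LinearMap.zero_apply, map_zero]
    | add X Y hX hY =>
      rw [← lieDerLin_apply, map_add, LinearMap.add_apply, map_add, lieDerLin_apply,
        lieDerLin_apply, hX, hY, add_zero]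
    | tmul z x =>
      rw [reExtension_apply, complexExterior_lieDer]
      induction complexExterior w with
      | zero => simp
      | add a b ha hb => simp only [map_add, ha, hb, add_zero]
      | tmul t v =>
        have h : β (lieDer x v) = 0 := hβinv x v
        simp [h]
  · obtain ⟨hu1, hu2⟩ := complexExterior_invariant hu
    obtain ⟨hw1, hw2⟩ := complexExterior_invariant hw
    -- `Re(ab) = Re a Re b - Im a Im b`, and each summand is a product of two positive invariants of
    -- `H`.
    rw [reExtension_apply, map_mul, rePart_mul, map_sub, hβmul _ hu1 _ hw1, hβmul _ hu2 _ hw2,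
      sub_zero]

/-- Real parts do not see the conjugation, so the antilinear extension of `θ` acts on them as `θ`
does. This is why the real part of the extension is taken. -/
theorem reExtension_mem_primitiveAnti {θ : H →ₗ[ℝ] H} {β : Module.Dual ℝ (ExteriorAlgebra ℝ H)}
    (hβ : β ∈ primitiveAnti θ) :
    reExtension β ∈
      primitiveAnti (TensorProduct.map Complex.conjAe.toAlgHom.toLinearMap θ) := by
  refine ⟨reExtension_mem_primitive hβ.1, fun w => ?_⟩
  rw [reExtension_apply, reExtension_apply, complexExterior_map, ← hβ.2]
  congr 1
  induction complexExterior w with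
  | zero => simp
  | add a b ha hb => simp only [map_add, ha, hb]
  | tmul z v => simp

/-- Pulling back forms along a surjective homomorphism of Lie algebras preserves primitive
elements. -/
theorem comp_map_mem_primitiveAnti_of_surjective {H' : Type*} [LieRing H'] [LieAlgebra ℝ H']
    (φ : H' →ₗ⁅ℝ⁆ H) (hφ : Function.Surjective φ) {θ : H →ₗ[ℝ] H} {θ' : H' →ₗ[ℝ] H'}
    (hθ : ∀ x, θ (φ x) = φ (θ' x)) {β : Module.Dual ℝ (ExteriorAlgebra ℝ H)}
    (hβ : β ∈ primitiveAnti θ) :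
    β ∘ₗ (ExteriorAlgebra.map (φ : H' →ₗ[ℝ] H)).toLinearMap ∈ primitiveAnti θ' := by
  obtain ⟨⟨hβ1, hβinv, hβmul⟩, hβθ⟩ := hβ
  have hpos : ∀ u ∈ posInvariants H',
      ExteriorAlgebra.map (φ : H' →ₗ[ℝ] H) u ∈ posInvariants H := by
    rintro u ⟨hu0, hu⟩
    refine ⟨by rw [algebraMapInv_map, hu0], fun y => ?_⟩
    obtain ⟨x, rfl⟩ := hφ y
    change lieDer (φ x) _ = 0
    rw [IsBoundary.lieDer_map, lieDer, hu, map_zero]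
  refine ⟨⟨by simpa using hβ1, fun x w => ?_, fun u hu w hw => ?_⟩, fun w => ?_⟩
  · change β (ExteriorAlgebra.map (φ : H' →ₗ[ℝ] H) (lieDer x w)) = 0
    rw [← IsBoundary.lieDer_map]
    exact hβinv _ _
  · change β (ExteriorAlgebra.map (φ : H' →ₗ[ℝ] H) (u * w)) = 0
    rw [map_mul]
    exact hβmul _ (hpos u hu) _ (hpos w hw)
  · change β (ExteriorAlgebra.map (φ : H' →ₗ[ℝ] H) (ExteriorAlgebra.map θ' w)) =
      -β (ExteriorAlgebra.map (φ : H' →ₗ[ℝ] H) w)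
    rw [← hβθ, ← AlgHom.comp_apply, ← AlgHom.comp_apply, ExteriorAlgebra.map_comp_map,
      ExteriorAlgebra.map_comp_map]
    congr 3
    ext x
    exact (hθ x).symm

end Complexification

/-! ### The complexified pair and the descent of surjectivity -/

namespace ReductivePair

variable {L : Type*} [LieRing L] [LieAlgebra ℝ L] (P : ReductivePair L)

/-- The embedding of a Lie algebra into its complexification. -/
noncomputable def toComplexification (L : Type*) [LieRing L] [LieAlgebra ℝ L] :
    L →ₗ⁅ℝ⁆ ℂ ⊗[ℝ] L where
  toLinearMap := TensorProduct.mk ℝ ℂ L 1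
  map_lie' {x y} := by simp

/-- The isomorphism of `ℂ ⊗ H` with its image in `ℂ ⊗ L`. -/
noncomputable def equivHC : ℂ ⊗[ℝ] P.H ≃ₗ⁅ℝ⁆ P.complexify.H :=
  LieEquiv.ofInjective (LieAlgebra.ExtendScalars.map (AlgHom.id ℝ ℂ) P.H.incl)
    (Module.Flat.lTensor_preserves_injective_linearMap (M := ℂ) P.H.toSubmodule.subtype
      P.H.toSubmodule.injective_subtype)

theorem equivHC_θ (w : ℂ ⊗[ℝ] P.H) :
    P.equivHC (TensorProduct.map Complex.conjAe.toAlgHom.toLinearMap P.θH w) =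
      P.complexify.θH (P.equivHC w) := by
  induction w with
  | zero => simp
  | add a b ha hb => simp only [map_add, ha, hb]
  | tmul z x => rfl

end ReductivePair

end RedPair

theorem mainTheorem8 {L₀ : Type*} [LieRing L₀] [LieAlgebra ℝ L₀] [FiniteDimensional ℝ L₀]
    (P₀ : RedPair.ReductivePair L₀) :
    ∃ (hC : P₀.complexify.RestWellDefined) (h₀ : P₀.RestWellDefined),
      Function.Surjective (P₀.complexify.restAnti hC) →
        Function.Surjective (P₀.restAnti h₀) := by
  refine ⟨P₀.complexify.restWellDefined, P₀.restWellDefined, fun hsurj => ?_⟩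
  rintro ⟨β, hβ⟩
  have hγ := RedPair.comp_map_mem_primitiveAnti_of_surjective
    (P₀.equivHC.symm : P₀.complexify.H →ₗ⁅ℝ⁆ TensorProduct ℝ ℂ P₀.H) P₀.equivHC.symm.surjective
    (θ' := P₀.complexify.θH) (fun x => by
      obtain ⟨w, rfl⟩ := P₀.equivHC.surjective x
      change TensorProduct.map Complex.conjAe.toAlgHom.toLinearMap P₀.θH
        (P₀.equivHC.symm (P₀.equivHC w)) = P₀.equivHC.symm (P₀.complexify.θH (P₀.equivHC w))
      rw [← P₀.equivHC_θ, LieEquiv.symm_apply_apply, LieEquiv.symm_apply_apply]) (RedPair.reExtension_mem_primitiveAnti hβ)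
  obtain ⟨⟨α, hα⟩, hrest⟩ := hsurj ⟨_, hγ⟩
  replace hrest := congrArg Subtype.val hrest
  -- The preimage of `β` is `α` pulled back along `x ↦ 1 ⊗ x`, whose image is stable under the
  -- antilinear extension of `θ`.
  refine ⟨⟨_, P₀.complexify.cartan.comp_map_mem_primitiveAnti
    (RedPair.ReductivePair.toComplexification L₀) (θ' := (P₀.θ : L₀ →ₗ[ℝ] L₀))
    (fun x => by
      change P₀.θConj (TensorProduct.tmul ℝ 1 x) = TensorProduct.tmul ℝ 1 (P₀.θ x)
      simp [RedPair.ReductivePair.θConj]) hα⟩, Subtype.ext (LinearMap.ext fun w => ?_)⟩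
  -- `k` is the real form of the subalgebra; evaluating `hrest` on its exterior algebra recovers
  -- `β`.
  let k : P₀.H →ₗ[ℝ] P₀.complexify.H :=
    (P₀.equivHC : TensorProduct ℝ ℂ P₀.H →ₗ[ℝ] P₀.complexify.H) ∘ₗ TensorProduct.mk ℝ ℂ P₀.H 1
  have hw := LinearMap.congr_fun hrest (ExteriorAlgebra.map k w)
  change α (ExteriorAlgebra.map _ (ExteriorAlgebra.map k w)) =
    RedPair.reExtension β (ExteriorAlgebra.map _ (ExteriorAlgebra.map k w)) at hw
  change α (ExteriorAlgebra.map _ (ExteriorAlgebra.map _ w)) = β w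
  rw [← AlgHom.comp_apply, ← AlgHom.comp_apply, ExteriorAlgebra.map_comp_map,
    ExteriorAlgebra.map_comp_map] at hw
  rw [← AlgHom.comp_apply, ExteriorAlgebra.map_comp_map]
  refine Eq.trans hw ?_
  have hk : ((P₀.equivHC.symm : P₀.complexify.H →ₗ⁅ℝ⁆ TensorProduct ℝ ℂ P₀.H) :
      P₀.complexify.H →ₗ[ℝ] TensorProduct ℝ ℂ P₀.H) ∘ₗ k = TensorProduct.mk ℝ ℂ P₀.H 1 := by
    ext x
    exact P₀.equivHC.symm_apply_apply _
  rw [hk, RedPair.reExtension_apply, RedPair.complexExterior_map_one_tmul, RedPair.rePart_tmul,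
    Complex.one_re, one_smul]
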